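/- Let $k$ be a field, let $H$ be a Hopf algebra over $k$ with comultiplication $\Delta$, counit $\varepsilon$ and bijective antipode, and let $P$ be a unital $k$-algebra that is a right $H$-comodule algebra: it carries a coassociative and counital coaction $\Delta_R: P\to P\otimes H$, $p\mapsto p_{(0)}\otimes p_{(1)}$, which is a homomorphism of algebras (unadorned tensor products are over $k$). Let $B=\{b\in P : \Delta_R(b)=b\otimes 1\}$ and assume that $B\subseteq P$ is an $H$-Galois extension, i.e. that the canonical map $$\chi: P\otimes_B P\to P\otimes H,\qquad p\otimes_B p'\mapsto p\,p'_{(0)}\otimes p'_{(1)},$$ is bijective. For an algebra $A$ write $\Omega^1A=\ker(A\otimes A\to A)$ for the kernel of the multiplication map and $\mathrm{d}a=1\otimes a-a\otimes 1$. Let $(\Omega^1B)P\subseteq P\otimes P$ be the $k$-span of all $\omega p$ and $P(\Omega^1B)P$ the $k$-span of all $p'\omega p$, with $\omega\in\Omega^1B$ and $p,p'\in P$. Assume that $B\subseteq P$ admits a strong connection, i.e. a left $P$-linear map $\Pi:\Omega^1P\to\Omega^1P$ such that $\Pi^2=\Pi$, $\ker\Pi=P(\Omega^1B)P$, $\Pi$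 is right $H$-colinear for the restriction to $\Omega^1P$ of the diagonal coaction $p\otimes p'\mapsto p_{(0)}\otimes p'_{(0)}\otimes p_{(1)}p'_{(1)}$ of $P\otimes P$, and $(\mathrm{id}-\Pi)(\mathrm{d}P)\subseteq(\Omega^1B)P$. Let $V$ be a finite-dimensional $k$-vector space and $\rho:V\to V\otimes H$ a corepresentation of $H$ (a coassociative and counital linear map). Then the space of colinear maps $$\mathrm{Hom}_\rho(V,P)=\{\varphi\in\mathrm{Hom}_k(V,P) : \Delta_R\circ\varphi=(\varphi\otimes\mathrm{id})\circ\rho\},$$ with the left $B$-module structure $(b\varphi)(v)=b\,\varphi(v)$, is finitely generated and projective as a left $B$-module. -/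

import Mathlib

open scoped TensorProduct

namespace HopfGalois

section Comodules

variable {k H V W : Type*} [Field k] [Ring H] [HopfAlgebra k H]
  [AddCommGroup V] [Module k V] [AddCommGroup W] [Module k W]

/-- A right coaction (corepresentation) `ρ : V → V ⊗ H`: coassociative and counital. -/
structure IsCorepresentation (ρ : V →ₗ[k] V ⊗[k] H) : Prop where
  coassoc : (TensorProduct.assoc k V H H).toLinearMap ∘ₗ ρ.rTensor H ∘ₗ ρ =
    (Coalgebra.comul (R := k) (A := H)).lTensor V ∘ₗ ρ
  counit : (TensorProduct.rid k V).toLinearMap ∘ₗ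
    (Coalgebra.counit (R := k) (A := H)).lTensor V ∘ₗ ρ = LinearMap.id

/-- A linear map `f : V → W` is colinear: `δ ∘ f = (f ⊗ id) ∘ ρ`. -/
def IsColinear (ρ : V →ₗ[k] V ⊗[k] H) (δ : W →ₗ[k] W ⊗[k] H) (f : V →ₗ[k] W) : Prop :=
  δ ∘ₗ f = f.rTensor H ∘ₗ ρ

end Comodules

section UniversalCalculus

variable (k A : Type*) [Field k] [Ring A] [Algebra k A]

/-- The multiplication map `A ⊗ A → A`, as a map of left `A`-modules. -/
noncomputable def mulMap : A ⊗[k] A →ₗ[A] A :=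
  { LinearMap.mul' k A with
    map_smul' := by
      intro a x
      induction x using TensorProduct.induction_on with
      | zero => simp
      | tmul x y => simp [TensorProduct.smul_tmul', mul_assoc]
      | add x y hx hy =>
        simp only [AddHom.toFun_eq_coe, LinearMap.coe_toAddHom, RingHom.id_apply] at hx hy ⊢
        rw [smul_add, map_add, hx, hy, map_add, smul_add] }

@[simp]
theorem mulMap_tmul (a b : A) : mulMap k A (a ⊗ₜ[k] b) = a * b := by
  simp [mulMap]

/-- The universal differential calculus `Ω¹A`: the kernel of the multiplication map,
a left `A`-submodule of `A ⊗ A`. -/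
noncomputable def universalForms : Submodule A (A ⊗[k] A) :=
  LinearMap.ker (mulMap k A)

/-- The universal differential `d a = 1 ⊗ a - a ⊗ 1`. -/
noncomputable def universalD (a : A) : universalForms k A :=
  ⟨(1 : A) ⊗ₜ[k] a - a ⊗ₜ[k] (1 : A), by simp [universalForms]⟩

/-- The inclusion `Ω¹A → A ⊗ A`, as a `k`-linear map. -/
noncomputable def formsIncl : universalForms k A →ₗ[k] A ⊗[k] A :=
  (universalForms k A).subtype.restrictScalars k

/-- The `k`-linear retraction `x ↦ x - m(x) ⊗ 1` of `A ⊗ A` onto `Ω¹A`. -/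
noncomputable def formsRetract : A ⊗[k] A →ₗ[k] universalForms k A where
  toFun x := ⟨x - mulMap k A x ⊗ₜ[k] (1 : A), by simp [universalForms]⟩
  map_add' x y := by
    ext
    simp only [map_add, TensorProduct.add_tmul, Submodule.coe_add]
    abel
  map_smul' c x := by
    ext
    simp [smul_sub, TensorProduct.smul_tmul']

end UniversalCalculus

section Extension

variable {k H P : Type*} [Field k] [Ring H] [HopfAlgebra k H] [Ring P] [Algebra k P]

/-- The subalgebra `B = P^{co H}` of coinvariants `{b | δ b = b ⊗ 1}`. -/
noncomputable def coinvariants (δ : P →ₐ[k] P ⊗[k] H) : Subalgebra k P :=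
  AlgHom.equalizer δ Algebra.TensorProduct.includeLeft

theorem mem_coinvariants {δ : P →ₐ[k] P ⊗[k] H} {b : P} :
    b ∈ coinvariants δ ↔ δ b = b ⊗ₜ[k] (1 : H) :=
  Iff.rfl

/-- The `k`-subspace of `P ⊗ P` spanned by `p b ⊗ p' - p ⊗ b p'` for `b ∈ B`. -/
noncomputable def balancingRelations (B : Subalgebra k P) : Submodule k (P ⊗[k] P) :=
  Submodule.span k
    {x | ∃ (p : P) (b : B) (p' : P), x = (p * b) ⊗ₜ[k] p' - p ⊗ₜ[k] ((b : P) * p')}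

/-- The tensor product `P ⊗_B P` over the (possibly noncommutative) subalgebra `B`. -/
abbrev BalancedTensor (B : Subalgebra k P) : Type _ :=
  (P ⊗[k] P) ⧸ balancingRelations B

/-- The map `P ⊗ P → P ⊗ H`, `p ⊗ p' ↦ p p'₍₀₎ ⊗ p'₍₁₎`. -/
noncomputable def preCanonicalMap (δ : P →ₐ[k] P ⊗[k] H) : P ⊗[k] P →ₗ[k] P ⊗[k] H :=
  (LinearMap.mul' k P).rTensor H ∘ₗ (TensorProduct.assoc k P P H).symm.toLinearMap ∘ₗ
    δ.toLinearMap.lTensor P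

theorem preCanonicalMap_tmul (δ : P →ₐ[k] P ⊗[k] H) (p p' : P) :
    preCanonicalMap δ (p ⊗ₜ[k] p') = (p ⊗ₜ[k] (1 : H)) * δ p' := by
  simp only [preCanonicalMap, LinearMap.comp_apply, LinearMap.lTensor_tmul,
    AlgHom.toLinearMap_apply]
  induction δ p' using TensorProduct.induction_on with
  | zero => simp
  | tmul x y => simp
  | add x y hx hy => rw [TensorProduct.tmul_add, map_add, map_add, hx, hy, mul_add]

theorem balancingRelations_le_ker (δ : P →ₐ[k] P ⊗[k] H) :
    balancingRelations (coinvariants δ) ≤ LinearMap.ker (preCanonicalMap δ) := by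
  refine Submodule.span_le.2 ?_
  rintro x ⟨p, b, p', rfl⟩
  have hb : δ (b : P) = (b : P) ⊗ₜ[k] (1 : H) := b.2
  simp [preCanonicalMap_tmul, hb, ← mul_assoc]

/-- The canonical map `χ : P ⊗_B P → P ⊗ H`, `p ⊗_B p' ↦ p p'₍₀₎ ⊗ p'₍₁₎`, where `B` is the
subalgebra of coinvariants. -/
noncomputable def canonicalMap (δ : P →ₐ[k] P ⊗[k] H) :
    BalancedTensor (coinvariants δ) →ₗ[k] P ⊗[k] H :=
  (balancingRelations (coinvariants δ)).liftQ (preCanonicalMap δ) (balancingRelations_le_ker δ)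

/-- `P`, with the coaction `δ`, is a right `H`-comodule algebra and `B = P^{co H} ⊆ P` is an
`H`-Galois extension: the canonical map is bijective. (That `δ` is an algebra map is part of its
type.) -/
structure IsHopfGaloisExtension (δ : P →ₐ[k] P ⊗[k] H) : Prop where
  isCorepresentation : IsCorepresentation δ.toLinearMap
  bijective_canonicalMap : Function.Bijective (canonicalMap δ)

/-- The diagonal coaction `p ⊗ p' ↦ p₍₀₎ ⊗ p'₍₀₎ ⊗ p₍₁₎ p'₍₁₎` on `P ⊗ P`. -/
noncomputable def diagonalCoaction (δ : P →ₐ[k] P ⊗[k] H) :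
    P ⊗[k] P →ₗ[k] (P ⊗[k] P) ⊗[k] H :=
  (LinearMap.mul' k H).lTensor (P ⊗[k] P) ∘ₗ
    (TensorProduct.tensorTensorTensorComm k P H P H).toLinearMap ∘ₗ
    TensorProduct.map δ.toLinearMap δ.toLinearMap

/-- The diagonal coaction restricted to `Ω¹P`. The restriction takes values in `Ω¹P ⊗ H`
(see `formsIncl_formsCoaction`); the retraction only serves to corestrict it. -/
noncomputable def formsCoaction (δ : P →ₐ[k] P ⊗[k] H) :
    universalForms k P →ₗ[k] universalForms k P ⊗[k] H :=
  (formsRetract k P).rTensor H ∘ₗ diagonalCoaction δ ∘ₗ formsIncl k P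

theorem mul_diagonalCoaction (δ : P →ₐ[k] P ⊗[k] H) (x : P ⊗[k] P) :
    (LinearMap.mul' k P).rTensor H (diagonalCoaction δ x) = δ (LinearMap.mul' k P x) := by
  induction x using TensorProduct.induction_on with
  | zero => simp
  | add x y hx hy => simp only [map_add, hx, hy]
  | tmul p q =>
    simp only [diagonalCoaction, LinearMap.comp_apply, TensorProduct.map_tmul,
      AlgHom.toLinearMap_apply, LinearMap.mul'_apply, map_mul]
    induction δ p using TensorProduct.induction_on with
    | zero => simp
    | add x y hx hy => simp only [TensorProduct.add_tmul, map_add, hx, hy, add_mul]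
    | tmul a h =>
      induction δ q using TensorProduct.induction_on with
      | zero => simp
      | add x y hx hy => simp only [TensorProduct.tmul_add, map_add, hx, hy, mul_add]
      | tmul b g => simp

/-- `formsCoaction` is the restriction of the diagonal coaction to `Ω¹P`. -/
theorem formsIncl_formsCoaction (δ : P →ₐ[k] P ⊗[k] H) (w : universalForms k P) :
    (formsIncl k P).rTensor H (formsCoaction δ w) = diagonalCoaction δ (w : P ⊗[k] P) := by
  have key : ∀ y : (P ⊗[k] P) ⊗[k] H,
      (formsIncl k P).rTensor H ((formsRetract k P).rTensor H y) =
        y - ((TensorProduct.mk k P P).flip 1).rTensor H ((LinearMap.mul' k P).rTensor H y) := by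
    intro y
    induction y using TensorProduct.induction_on with
    | zero => simp
    | add x y hx hy => simp only [map_add, hx, hy]; abel
    | tmul x h =>
      simp [formsIncl, formsRetract, mulMap, TensorProduct.sub_tmul]
  have hw : LinearMap.mul' k P (w : P ⊗[k] P) = 0 := w.2
  rw [formsCoaction, LinearMap.comp_apply, LinearMap.comp_apply, key]
  change diagonalCoaction δ (w : P ⊗[k] P) - _ = _
  rw [show formsIncl k P w = (w : P ⊗[k] P) from rfl, mul_diagonalCoaction, hw]
  simp

/-- The `k`-subspace `(Ω¹B)P` of `P ⊗ P`: sums of elements `∑ᵢ bᵢ ⊗ b'ᵢ p` with `p ∈ P` and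
`∑ᵢ bᵢ ⊗ b'ᵢ ∈ Ω¹B`. -/
noncomputable def formsMul (B : Subalgebra k P) : Submodule k (P ⊗[k] P) :=
  Submodule.span k
    {x | ∃ w ∈ universalForms k B, ∃ p : P,
      x = (LinearMap.mulRight k p).lTensor P
        (TensorProduct.map B.val.toLinearMap B.val.toLinearMap w)}

/-- The horizontal forms `P(Ω¹B)P`: the left `P`-submodule generated by `(Ω¹B)P`. -/
noncomputable def horizontalForms (B : Subalgebra k P) : Submodule P (P ⊗[k] P) :=
  Submodule.span P (formsMul B : Set (P ⊗[k] P))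

/-- A connection: a left `P`-linear right `H`-colinear idempotent endomorphism of `Ω¹P` whose
kernel is the space `P(Ω¹B)P` of horizontal forms. -/
structure IsConnection (δ : P →ₐ[k] P ⊗[k] H)
    (pr : universalForms k P →ₗ[P] universalForms k P) : Prop where
  idempotent : pr ∘ₗ pr = pr
  ker_eq : (LinearMap.ker pr).map (universalForms k P).subtype = horizontalForms (coinvariants δ)
  colinear : IsColinear (formsCoaction δ) (formsCoaction δ) (pr.restrictScalars k)

/-- A strong connection: a connection with `(id - pr)(dP) ⊆ (Ω¹B)P`. -/
structure IsStrongConnection (δ : P →ₐ[k] P ⊗[k] H)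
    (pr : universalForms k P →ₗ[P] universalForms k P) : Prop extends IsConnection δ pr where
  strong : ∀ p : P, ((universalD k P p - pr (universalD k P p) : universalForms k P) : P ⊗[k] P) ∈
    formsMul (coinvariants δ)

variable {V : Type*} [AddCommGroup V] [Module k V]

/-- The left `B`-module `Hom_ρ(V, P)` of colinear maps `V → P`, with `(b • φ) v = b * φ v`. -/
noncomputable def colinearHom (ρ : V →ₗ[k] V ⊗[k] H) (δ : P →ₐ[k] P ⊗[k] H) :
    Submodule (coinvariants δ) (V →ₗ[k] P) where
  carrier := {φ | IsColinear ρ δ.toLinearMap φ}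
  zero_mem' := by simp [IsColinear]
  add_mem' := by
    intro f g hf hg
    change _ = _ at hf hg ⊢
    rw [LinearMap.comp_add, hf, hg, LinearMap.rTensor_add, LinearMap.add_comp]
  smul_mem' := by
    intro b f hf
    change _ = _ at hf ⊢
    have hb : δ (b : P) = (b : P) ⊗ₜ[k] (1 : H) := b.2
    ext v
    have hv : δ (f v) = f.rTensor H (ρ v) := LinearMap.congr_fun hf v
    have h1 : δ ((b • f) v) = ((b : P) ⊗ₜ[k] (1 : H)) * δ (f v) := by
      rw [← hb, ← map_mul]; rfl
    simp only [LinearMap.comp_apply, AlgHom.toLinearMap_apply]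
    rw [h1, hv]
    induction ρ v using TensorProduct.induction_on with
    | zero => simp
    | add x y hx hy => simp only [map_add, mul_add, hx, hy]
    | tmul x h =>
      simp only [LinearMap.rTensor_tmul, Algebra.TensorProduct.tmul_mul_tmul, one_mul]
      rfl

end Extension

end HopfGalois

namespace HopfGalois

/-! ### Linear algebra: generalized inverses, dual bases, coordinates of the right leg of `P ⊗ P`.
-/

section LinearAlgebra

/-! The strong connection gives `s(p) = p ⊗ 1 + Π(dp)` (`splitting`), a left `B`-linear colinear map
`P → B ⊗ P` with `m ∘ s = id`. For colinear `φ`, expanding `s ∘ φ` in bases of `P` and `V` gives `∑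
cₓ(φ) ⊗ Eₓ`, with `cₓ` a `B`-linear, `B`-valued functional and `Eₓ : V → P` independent of `φ`;
multiplying out, `φ = ∑ cₓ(φ) Eₓ`.

Two things separate this from a finite dual basis. Finiteness: the left `P`-linear extension of `s`
factors through `χ`, and `χ(1 ⊗ φ(v)) = (φ ⊗ id)(ρ(v))`, so the right legs of `s(φ(v))` are
controlled by the finitely many elements of `H` occurring in `ρ` (`exists_finset_splitting`).
Colinearity: the `Eₓ` need not be colinear, but with `D` the colinearity defect, `∑ cₓ(φ) ⊗ D(Eₓ) =
0` (`sum_tmul_colinearityDefect_eq_zero`). If `D L D = D`, then each `Eₓ - L(D(Eₓ))` is colinear and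
replacing `Eₓ` by it leaves the sum unchanged. -/

/-- Every linear map of vector spaces has a generalized inverse. -/
theorem exists_generalizedInverse {k E F : Type*} [Field k] [AddCommGroup E] [Module k E]
    [AddCommGroup F] [Module k F] (f : E →ₗ[k] F) : ∃ g : F →ₗ[k] E, f ∘ₗ g ∘ₗ f = f := by
  obtain ⟨r, hr⟩ := LinearMap.exists_rightInverse_of_surjective f.rangeRestrict f.range_rangeRestrict
  obtain ⟨g, hg⟩ := LinearMap.exists_extend r
  refine ⟨g, LinearMap.ext fun x => ?_⟩
  have h₁ : g (f x) = r (f.rangeRestrict x) := LinearMap.congr_fun hg (f.rangeRestrict x)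
  have h₂ : f.rangeRestrict (r (f.rangeRestrict x)) = f.rangeRestrict x :=
    LinearMap.congr_fun hr (f.rangeRestrict x)
  simpa [h₁] using congrArg Subtype.val h₂

/-- A module with a finite dual basis is finitely generated and projective. -/
theorem finite_projective_of_dualBasis {R M ι : Type*} [Semiring R] [AddCommMonoid M] [Module R M]
    [Fintype ι] (c : ι → M →ₗ[R] R) (e : ι → M) (h : ∀ m : M, ∑ i, c i m • e i = m) :
    Module.Finite R M ∧ Module.Projective R M := by
  have hid : Fintype.linearCombination R e ∘ₗ LinearMap.pi c = LinearMap.id :=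
    LinearMap.ext fun m => by simpa [Fintype.linearCombination_apply] using h m
  refine ⟨Module.Finite.of_surjective (Fintype.linearCombination R e) fun m =>
    ⟨LinearMap.pi c m, LinearMap.congr_fun hid m⟩, Module.Projective.of_split _ _ hid⟩

variable {k P : Type*} [Field k] [Ring P] [Algebra k P]

/-- Contraction of the right leg `p ⊗ q ↦ f(q) p`, as a map of left `P`-modules. -/
noncomputable def contractRight (f : P →ₗ[k] k) : P ⊗[k] P →ₗ[P] P :=
  (TensorProduct.AlgebraTensorModule.rid k P P).toLinearMap ∘ₗ
    TensorProduct.AlgebraTensorModule.lTensor P P f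

@[simp]
theorem contractRight_tmul (f : P →ₗ[k] k) (p q : P) :
    contractRight f (p ⊗ₜ[k] q) = f q • p := by
  simp [contractRight]

theorem contractRight_eq_rid_lTensor (f : P →ₗ[k] k) (x : P ⊗[k] P) :
    contractRight f x = TensorProduct.rid k P (f.lTensor P x) := by
  induction x using TensorProduct.induction_on with
  | zero => simp
  | add x y hx hy => simp only [map_add, hx, hy]
  | tmul p q => simp

variable {ι : Type*} (b : Module.Basis ι k P)

theorem exists_finset_contractRight_eq_zero (x : P ⊗[k] P) :
    ∃ S : Finset ι, ∀ i ∉ S, contractRight (b.coord i) x = 0 := by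
  classical
  refine ⟨(TensorProduct.equivFinsuppOfBasisRight b x).support, fun i hi => ?_⟩
  rw [contractRight_eq_rid_lTensor, ← TensorProduct.equivFinsuppOfBasisRight_apply]
  simpa using hi

theorem sum_contractRight_tmul {x : P ⊗[k] P} {S : Finset ι}
    (hS : ∀ i ∉ S, contractRight (b.coord i) x = 0) :
    ∑ i ∈ S, contractRight (b.coord i) x ⊗ₜ[k] b i = x := by
  classical
  conv_rhs => rw [← (TensorProduct.equivFinsuppOfBasisRight b).symm_apply_apply x,
    TensorProduct.equivFinsuppOfBasisRight_symm_apply]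
  simp only [contractRight_eq_rid_lTensor, ← TensorProduct.equivFinsuppOfBasisRight_apply]
    at hS ⊢
  symm
  apply Finsupp.sum_of_support_subset _ _ _ (by simp)
  intro i hi
  by_contra h
  exact (Finsupp.mem_support_iff.1 hi) (hS i h)

/-- The extension `p ⊗ q ↦ p • s(q)` of a linear map `s : P → P ⊗ P` to a left `P`-linear map. -/
noncomputable def leftExtend (s : P →ₗ[k] P ⊗[k] P) : P ⊗[k] P →ₗ[k] P ⊗[k] P :=
  TensorProduct.lift ((Algebra.lsmul k k (P ⊗[k] P)).toLinearMap.compl₂ s)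

@[simp]
theorem leftExtend_tmul (s : P →ₗ[k] P ⊗[k] P) (p q : P) :
    leftExtend s (p ⊗ₜ[k] q) = p • s q := by
  simp [leftExtend]

theorem leftExtend_smul (s : P →ₗ[k] P ⊗[k] P) (p : P) (x : P ⊗[k] P) :
    leftExtend s (p • x) = p • leftExtend s x := by
  induction x using TensorProduct.induction_on with
  | zero => simp
  | add x y hx hy => simp only [smul_add, map_add, hx, hy]
  | tmul q r => simp [TensorProduct.smul_tmul', mul_smul]

/-- The subspace `B ⊗ P` of `P ⊗ P`. -/
noncomputable def leftLegIn (B : Subalgebra k P) : Submodule k (P ⊗[k] P) :=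
  LinearMap.range (B.val.toLinearMap.rTensor P)

theorem contractRight_mem {B : Subalgebra k P} (f : P →ₗ[k] k) {x : P ⊗[k] P}
    (hx : x ∈ leftLegIn B) : contractRight f x ∈ B := by
  obtain ⟨y, rfl⟩ := hx
  induction y using TensorProduct.induction_on with
  | zero => simp
  | add x y hx hy => simpa only [map_add] using B.add_mem hx hy
  | tmul c q =>
    simpa using B.smul_mem c.2 (f q)

theorem formsMul_le_leftLegIn (B : Subalgebra k P) : formsMul B ≤ leftLegIn B := by
  refine Submodule.span_le.2 ?_
  rintro x ⟨w, -, p, rfl⟩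
  refine ⟨(LinearMap.mulRight k p ∘ₗ B.val.toLinearMap).lTensor B w, ?_⟩
  induction w using TensorProduct.induction_on with
  | zero => simp
  | add x y hx hy => simp only [map_add, hx, hy]
  | tmul c c' => simp

end LinearAlgebra

/-! ### The diagonal coaction and the splitting of the multiplication `B ⊗ P → P`. -/

section Extension

variable {k H P : Type*} [Field k] [Ring H] [HopfAlgebra k H] [Ring P] [Algebra k P]
  {δ : P →ₐ[k] P ⊗[k] H}

theorem diagonalCoaction_tmul (p q : P) : diagonalCoaction δ (p ⊗ₜ[k] q) =
    (LinearMap.mul' k H).lTensor (P ⊗[k] P)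
      (TensorProduct.tensorTensorTensorComm k P H P H (δ p ⊗ₜ[k] δ q)) := by
  simp [diagonalCoaction]

theorem diagonalCoaction_tmul_of_mem {c : P} (hc : c ∈ coinvariants δ) (q : P) :
    TensorProduct.assoc k P P H (diagonalCoaction δ (c ⊗ₜ[k] q)) = c ⊗ₜ[k] δ q := by
  rw [diagonalCoaction_tmul, mem_coinvariants.1 hc]
  induction δ q using TensorProduct.induction_on with
  | zero => simp
  | add x y hx hy => simp only [TensorProduct.tmul_add, map_add, hx, hy]
  | tmul q h => simp

theorem diagonalCoaction_tmul_one (p : P) : diagonalCoaction δ (p ⊗ₜ[k] (1 : P)) =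
    ((TensorProduct.mk k P P).flip 1).rTensor H (δ p) := by
  rw [diagonalCoaction_tmul, map_one, Algebra.TensorProduct.one_def]
  induction δ p using TensorProduct.induction_on with
  | zero => simp
  | add x y hx hy => simp only [TensorProduct.add_tmul, map_add, hx, hy]
  | tmul q h => simp

theorem diagonalCoaction_one_tmul (p : P) : diagonalCoaction δ ((1 : P) ⊗ₜ[k] p) =
    (TensorProduct.mk k P P 1).rTensor H (δ p) := by
  rw [diagonalCoaction_tmul, map_one, Algebra.TensorProduct.one_def]
  induction δ p using TensorProduct.induction_on with
  | zero => simp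
  | add x y hx hy => simp only [TensorProduct.tmul_add, map_add, hx, hy]
  | tmul q h => simp

/-- On `B ⊗ P` the diagonal coaction is `id ⊗ δ`. -/
theorem assoc_diagonalCoaction_of_mem {x : P ⊗[k] P} (hx : x ∈ leftLegIn (coinvariants δ)) :
    TensorProduct.assoc k P P H (diagonalCoaction δ x) = δ.toLinearMap.lTensor P x := by
  obtain ⟨y, rfl⟩ := hx
  induction y using TensorProduct.induction_on with
  | zero => simp
  | add x y hx hy => simp only [map_add, hx, hy]
  | tmul c q => simpa using diagonalCoaction_tmul_of_mem c.2 q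

/-- The map `p ↦ p ⊗ 1 + pr (d p)` attached to a left `P`-linear endomorphism of `Ω¹P`. For a
strong connection it is a `B`-linear colinear splitting of the multiplication `B ⊗ P → P`. -/
noncomputable def splitting (pr : universalForms k P →ₗ[P] universalForms k P) :
    P →ₗ[k] P ⊗[k] P :=
  (TensorProduct.mk k P P).flip 1 +
    formsIncl k P ∘ₗ pr.restrictScalars k ∘ₗ formsRetract k P ∘ₗ TensorProduct.mk k P P 1

variable {pr : universalForms k P →ₗ[P] universalForms k P}

theorem formsRetract_one_tmul (p : P) :
    formsRetract k P ((1 : P) ⊗ₜ[k] p) = universalD k P p := by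
  ext
  simp [formsRetract, universalD]

theorem splitting_apply (p : P) :
    splitting pr p = p ⊗ₜ[k] (1 : P) + (pr (universalD k P p) : P ⊗[k] P) := by
  simp [splitting, formsRetract_one_tmul, formsIncl]

theorem mul'_splitting (p : P) : LinearMap.mul' k P (splitting pr p) = p := by
  have h : LinearMap.mul' k P (pr (universalD k P p) : P ⊗[k] P) = 0 :=
    (pr (universalD k P p)).2
  rw [splitting_apply, map_add, h]
  simp

/-- Here `s(p) = 1 ⊗ p - (id - Π)(dp)`, and strongness puts the second term in `(Ω¹B)P ⊆ B ⊗ P`. -/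
theorem IsStrongConnection.splitting_mem (h : IsStrongConnection δ pr) (p : P) :
    splitting pr p ∈ leftLegIn (coinvariants δ) := by
  have h₁ := formsMul_le_leftLegIn _ (h.strong p)
  have h₂ : (1 : P) ⊗ₜ[k] p ∈ leftLegIn (coinvariants δ) := ⟨1 ⊗ₜ[k] p, by simp⟩
  have h₃ := sub_mem h₂ h₁
  convert h₃ using 1
  rw [splitting_apply]
  simp only [universalD, Submodule.coe_sub]
  abel

theorem IsConnection.apply_eq_zero (h : IsConnection δ pr) {w : universalForms k P}
    (hw : (w : P ⊗[k] P) ∈ horizontalForms (coinvariants δ)) : pr w = 0 := by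
  rw [← h.ker_eq] at hw
  obtain ⟨w', hw', heq⟩ := hw
  rwa [← Subtype.ext heq]

/-- By the Leibniz rule `d(cp) - c dp = (dc)p`, which is horizontal and hence killed by `Π`. -/
theorem IsConnection.splitting_mul (h : IsConnection δ pr) {c : P} (hc : c ∈ coinvariants δ)
    (p : P) : splitting pr (c * p) = c • splitting pr p := by
  set w : universalForms k P := universalD k P (c * p) - c • universalD k P p with hw
  have hcoe : (w : P ⊗[k] P) = (1 : P) ⊗ₜ[k] (c * p) - c ⊗ₜ[k] p := by
    simp [hw, universalD, smul_sub, TensorProduct.smul_tmul']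
  have hzero : pr w = 0 := by
    refine h.apply_eq_zero (Submodule.subset_span (Submodule.subset_span ?_))
    refine ⟨_, (universalD k (coinvariants δ) ⟨c, hc⟩).2, p, ?_⟩
    rw [hcoe]
    simp [universalD]
  rw [hw, map_sub, sub_eq_zero, map_smul] at hzero
  rw [splitting_apply, splitting_apply, hzero, smul_add, TensorProduct.smul_tmul']
  rfl

theorem IsConnection.diagonalCoaction_splitting (h : IsConnection δ pr) (p : P) :
    diagonalCoaction δ (splitting pr p) = (splitting pr).rTensor H (δ p) := by
  have hd : formsCoaction δ (universalD k P p) =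
      (formsRetract k P ∘ₗ TensorProduct.mk k P P 1).rTensor H (δ p) := by
    have hz : ∀ q : P, formsRetract k P (q ⊗ₜ[k] (1 : P)) = 0 := fun q => by
      ext; simp [formsRetract]
    -- The retraction kills `q ⊗ 1`, so only the `1 ⊗ p` half of `dp` contributes to its coaction.
    have hz' : formsRetract k P ∘ₗ (TensorProduct.mk k P P).flip 1 = 0 :=
      LinearMap.ext fun q => by simpa using hz q
    have hcoe : formsIncl k P (universalD k P p) = (1 : P) ⊗ₜ[k] p - p ⊗ₜ[k] (1 : P) := rfl
    rw [formsCoaction, LinearMap.comp_apply, LinearMap.comp_apply, hcoe, map_sub,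
      diagonalCoaction_one_tmul, diagonalCoaction_tmul_one, map_sub,
      ← LinearMap.comp_apply, ← LinearMap.comp_apply, ← LinearMap.rTensor_comp,
      ← LinearMap.rTensor_comp, hz']
    simp
  have hc : formsCoaction δ (pr (universalD k P p)) =
      (pr.restrictScalars k).rTensor H (formsCoaction δ (universalD k P p)) :=
    LinearMap.congr_fun h.colinear (universalD k P p)
  rw [splitting_apply, map_add, diagonalCoaction_tmul_one, ← formsIncl_formsCoaction, hc, hd,
    splitting, LinearMap.rTensor_add, LinearMap.add_apply]
  simp only [LinearMap.rTensor_comp, LinearMap.comp_apply]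

/-! ### Finiteness of the right legs via the canonical map. -/

theorem preCanonicalMap_smul (p : P) (x : P ⊗[k] P) :
    preCanonicalMap δ (p • x) = (p ⊗ₜ[k] (1 : H)) * preCanonicalMap δ x := by
  induction x using TensorProduct.induction_on with
  | zero => simp
  | add x y hx hy => simp only [smul_add, map_add, mul_add, hx, hy]
  | tmul q r => simp [TensorProduct.smul_tmul', preCanonicalMap_tmul, ← mul_assoc]

/-- The left `P`-linear extension of the splitting factors through the canonical map. -/
theorem leftExtend_splitting_eq (hδ : IsHopfGaloisExtension δ) (h : IsConnection δ pr)
    {x y : P ⊗[k] P} (hxy : preCanonicalMap δ x = preCanonicalMap δ y) :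
    leftExtend (splitting pr) x = leftExtend (splitting pr) y := by
  have hker : balancingRelations (coinvariants δ) ≤
      LinearMap.ker (leftExtend (splitting pr)) := by
    refine Submodule.span_le.2 ?_
    rintro _ ⟨p, c, p', rfl⟩
    simp [h.splitting_mul c.2, mul_smul]
  have hmk : (balancingRelations (coinvariants δ)).mkQ x =
      (balancingRelations (coinvariants δ)).mkQ y :=
    hδ.bijective_canonicalMap.1 hxy
  rw [← sub_eq_zero, ← map_sub]
  exact hker ((Submodule.Quotient.eq _).1 hmk)

theorem exists_preCanonicalMap_eq (hδ : IsHopfGaloisExtension δ) (z : P ⊗[k] H) :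
    ∃ x, preCanonicalMap δ x = z := by
  obtain ⟨y, rfl⟩ := hδ.bijective_canonicalMap.2 z
  obtain ⟨x, rfl⟩ := Submodule.mkQ_surjective _ y
  exact ⟨x, rfl⟩

variable {V ι : Type*} [AddCommGroup V] [Module k V] (b : Module.Basis ι k P)

/-- The quantifier order is the point: `S` is chosen before `φ`. A preimage of `φ(v) ⊗ g` is `φ(v)`
times a fixed preimage of `1 ⊗ g`, and left multiplication creates no new right-leg coordinates. -/
theorem exists_finset_of_tensor (hδ : IsHopfGaloisExtension δ)
    (s : P →ₗ[k] P ⊗[k] P) (z : V ⊗[k] H) : ∃ S : Finset ι, ∀ φ : V →ₗ[k] P,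
      ∃ x, preCanonicalMap δ x = φ.rTensor H z ∧
        ∀ i ∉ S, contractRight (b.coord i) (leftExtend s x) = 0 := by
  classical
  induction z using TensorProduct.induction_on with
  | zero => exact ⟨∅, fun φ => ⟨0, by simp⟩⟩
  | add z z' hz hz' =>
    obtain ⟨S, hS⟩ := hz
    obtain ⟨S', hS'⟩ := hz'
    refine ⟨S ∪ S', fun φ => ?_⟩
    obtain ⟨x, hx, hx0⟩ := hS φ
    obtain ⟨x', hx', hx0'⟩ := hS' φ
    refine ⟨x + x', by simp [hx, hx'], fun i hi => ?_⟩
    rw [Finset.mem_union, not_or] at hi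
    rw [map_add, map_add, hx0 i hi.1, hx0' i hi.2, add_zero]
  | tmul v g =>
    obtain ⟨x, hx⟩ := exists_preCanonicalMap_eq hδ ((1 : P) ⊗ₜ[k] g)
    obtain ⟨S, hS⟩ := exists_finset_contractRight_eq_zero b (leftExtend s x)
    refine ⟨S, fun φ => ⟨φ v • x, by simp [preCanonicalMap_smul, hx], fun i hi => ?_⟩⟩
    rw [leftExtend_smul, map_smul, hS i hi, smul_zero]

/-- For finite-dimensional `V`, the right legs of `splitting pr (φ v)`, with `φ : V → P` colinear,
lie in a finite-dimensional subspace which does not depend on `φ`. -/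
theorem exists_finset_splitting [FiniteDimensional k V] (hδ : IsHopfGaloisExtension δ)
    (h : IsConnection δ pr) (ρ : V →ₗ[k] V ⊗[k] H) :
    ∃ S : Finset ι, ∀ φ : V →ₗ[k] P, IsColinear ρ δ.toLinearMap φ → ∀ v, ∀ i ∉ S,
      contractRight (b.coord i) (splitting pr (φ v)) = 0 := by
  classical
  have e := Module.finBasis k V
  choose S hS using fun j => exists_finset_of_tensor b hδ (splitting pr) (ρ (e j))
  refine ⟨Finset.univ.biUnion S, fun φ hφ v i hi => ?_⟩
  suffices hz : (contractRight (b.coord i)).restrictScalars k ∘ₗ splitting pr ∘ₗ φ = 0 from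
    LinearMap.congr_fun hz v
  refine e.ext fun j => ?_
  obtain ⟨x, hx, hx0⟩ := hS j φ
  -- Both sides equal `δ(φ(e j))`, by colinearity of `φ`.
  have hcan : preCanonicalMap δ ((1 : P) ⊗ₜ[k] φ (e j)) = preCanonicalMap δ x := by
    rw [hx, preCanonicalMap_tmul, ← Algebra.TensorProduct.one_def, one_mul]
    exact LinearMap.congr_fun hφ (e j)
  have heq := leftExtend_splitting_eq hδ h hcan
  rw [leftExtend_tmul, one_smul] at heq
  simp only [LinearMap.comp_apply, LinearMap.restrictScalars_apply, LinearMap.zero_apply, heq]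
  exact hx0 i fun hij => hi (Finset.mem_biUnion.2 ⟨j, Finset.mem_univ j, hij⟩)

/-! ### The colinearity defect. -/

/-- The defect of colinearity `f ↦ δ ∘ f - (f ⊗ id) ∘ ρ`. -/
noncomputable def colinearityDefect (ρ : V →ₗ[k] V ⊗[k] H) (δ : P →ₐ[k] P ⊗[k] H) :
    (V →ₗ[k] P) →ₗ[k] V →ₗ[k] P ⊗[k] H :=
  LinearMap.llcomp k V P (P ⊗[k] H) δ.toLinearMap -
    (LinearMap.llcomp k V (V ⊗[k] H) (P ⊗[k] H)).flip ρ ∘ₗ LinearMap.rTensorHom H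

theorem colinearityDefect_apply (ρ : V →ₗ[k] V ⊗[k] H) (f : V →ₗ[k] P) (v : V) :
    colinearityDefect ρ δ f v = δ (f v) - f.rTensor H (ρ v) := by
  simp [colinearityDefect]

theorem colinearityDefect_eq_zero_iff (ρ : V →ₗ[k] V ⊗[k] H) (f : V →ₗ[k] P) :
    colinearityDefect ρ δ f = 0 ↔ IsColinear ρ δ.toLinearMap f := by
  simp [LinearMap.ext_iff, IsColinear, colinearityDefect_apply, sub_eq_zero]

/-- If `∑ᵢ pᵢ ⊗ fᵢ`, as a map `V → P ⊗ P`, is colinear for the coaction on the right leg, then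
`∑ᵢ pᵢ ⊗ (δ ∘ fᵢ - (fᵢ ⊗ id) ∘ ρ)` vanishes. -/
theorem sum_tmul_colinearityDefect_eq_zero [FiniteDimensional k V] {ρ : V →ₗ[k] V ⊗[k] H}
    {α : Type*} (T : Finset α) (p : α → P) (f : α → V →ₗ[k] P) (g : V →ₗ[k] P ⊗[k] P)
    (hg : ∀ v, g v = ∑ i ∈ T, p i ⊗ₜ[k] f i v)
    (hcol : ∀ v, δ.toLinearMap.lTensor P (g v) =
      TensorProduct.assoc k P P H (g.rTensor H (ρ v))) :
    ∑ i ∈ T, p i ⊗ₜ[k] colinearityDefect ρ δ (f i) = 0 := by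
  -- As `V` is finite-dimensional, `P ⊗ Hom(V, P ⊗ H) ≅ Hom(V, P ⊗ (P ⊗ H))`, so vanishing can be
  -- tested at each `v`.
  apply (lTensorHomEquivHomLTensor k V P (P ⊗[k] H)).injective
  ext v
  have hr : ∀ z : V ⊗[k] H, TensorProduct.assoc k P P H (g.rTensor H z) =
      ∑ i ∈ T, p i ⊗ₜ[k] (f i).rTensor H z := by
    intro z
    induction z using TensorProduct.induction_on with
    | zero => simp
    | add x y hx hy => simp only [map_add, hx, hy, TensorProduct.tmul_add, Finset.sum_add_distrib]
    | tmul w a => simp [hg, TensorProduct.sum_tmul]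
  have hv := hcol v
  rw [hr, hg] at hv
  simp only [map_sum, LinearMap.lTensor_tmul, AlgHom.toLinearMap_apply] at hv
  simp [lTensorHomEquivHomLTensor_apply, TensorProduct.lTensorHomToHomLTensor_apply,
    colinearityDefect_apply, TensorProduct.tmul_sub, hv]

end Extension

end HopfGalois

namespace HopfGalois

/-! ### The finite dual basis of `Hom_ρ(V, P)`. -/

section DualBasis

variable {k H P V ι : Type*} [Field k] [Ring H] [HopfAlgebra k H] [Ring P] [Algebra k P]
  [AddCommGroup V] [Module k V] {δ : P →ₐ[k] P ⊗[k] H}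
  {pr : universalForms k P →ₗ[P] universalForms k P}

/-- The `B`-valued coordinate `φ ↦ (id ⊗ f)(splitting pr (φ v))` on colinear maps. -/
noncomputable def splittingCoord (h : IsStrongConnection δ pr) (ρ : V →ₗ[k] V ⊗[k] H)
    (f : P →ₗ[k] k) (v : V) : colinearHom ρ δ →ₗ[coinvariants δ] coinvariants δ where
  toFun φ := ⟨contractRight f (splitting pr (φ.1 v)), contractRight_mem f (h.splitting_mem _)⟩
  map_add' φ ψ := by
    ext
    simp
  map_smul' c φ := by
    ext
    change contractRight f (splitting pr ((c : P) * φ.1 v)) = (c : P) * _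
    rw [h.splitting_mul c.2, map_smul, smul_eq_mul]

theorem IsStrongConnection.lTensor_splitting (h : IsStrongConnection δ pr)
    {ρ : V →ₗ[k] V ⊗[k] H} {φ : V →ₗ[k] P} (hφ : IsColinear ρ δ.toLinearMap φ) (v : V) :
    δ.toLinearMap.lTensor P (splitting pr (φ v)) =
      TensorProduct.assoc k P P H ((splitting pr ∘ₗ φ).rTensor H (ρ v)) := by
  have hv : δ (φ v) = φ.rTensor H (ρ v) := LinearMap.congr_fun hφ v
  rw [← assoc_diagonalCoaction_of_mem (h.splitting_mem _), h.diagonalCoaction_splitting, hv,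
    LinearMap.rTensor_comp, LinearMap.comp_apply]

/-- Expansion of `splitting pr ∘ φ` in a basis of `V` and a basis of `P`. -/
theorem splitting_eq_sum {n : Type*} [Fintype n] (e : Module.Basis n k V)
    (b : Module.Basis ι k P) {S : Finset ι} {φ : V →ₗ[k] P}
    (hS : ∀ v, ∀ i ∉ S, contractRight (b.coord i) (splitting pr (φ v)) = 0) (v : V) :
    splitting pr (φ v) = ∑ x : S × n, contractRight (b.coord x.1) (splitting pr (φ (e x.2))) ⊗ₜ[k]
      (e.coord x.2).smulRight (b x.1) v := by
  have hbasis : ∀ j, splitting pr (φ (e j)) =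
      ∑ i : S, contractRight (b.coord i) (splitting pr (φ (e j))) ⊗ₜ[k] b i := fun j => by
    conv_lhs => rw [← sum_contractRight_tmul b (hS (e j))]
    exact (Finset.sum_coe_sort S _).symm
  conv_lhs => rw [← e.sum_repr v]
  rw [map_sum, map_sum, Fintype.sum_prod_type_right]
  refine Finset.sum_congr rfl fun j _ => ?_
  rw [map_smul, map_smul, hbasis j, Finset.smul_sum]
  refine Finset.sum_congr rfl fun i _ => ?_
  simp

theorem finite_projective_colinearHom [FiniteDimensional k V] (hδ : IsHopfGaloisExtension δ)
    (h : IsStrongConnection δ pr) (ρ : V →ₗ[k] V ⊗[k] H) :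
    Module.Finite (coinvariants δ) (colinearHom ρ δ) ∧
      Module.Projective (coinvariants δ) (colinearHom ρ δ) := by
  let b := Module.Basis.ofVectorSpace k P
  let e := Module.finBasis k V
  obtain ⟨S, hS⟩ := exists_finset_splitting b hδ h.toIsConnection ρ
  obtain ⟨L, hL⟩ := exists_generalizedInverse (colinearityDefect ρ δ)
  let E : S × Fin (Module.finrank k V) → V →ₗ[k] P := fun x => (e.coord x.2).smulRight (b x.1)
  -- `D(E - L(D(E))) = D(E) - D(E) = 0`.
  have hE : ∀ x, E x - L (colinearityDefect ρ δ (E x)) ∈ colinearHom ρ δ := fun x => by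
    refine (colinearityDefect_eq_zero_iff ρ _).1 ?_
    rw [map_sub, sub_eq_zero]
    exact (LinearMap.congr_fun hL (E x)).symm
  refine finite_projective_of_dualBasis (fun x : S × Fin (Module.finrank k V) =>
    splittingCoord h ρ (b.coord x.1) (e x.2))
    (fun x => (⟨_, hE x⟩ : colinearHom ρ δ)) fun φ => ?_
  have hsum := splitting_eq_sum (pr := pr) e b (hS φ.1 φ.2)
  have hzero := sum_tmul_colinearityDefect_eq_zero Finset.univ _ E (splitting pr ∘ₗ φ.1) hsum
    (h.lTensor_splitting φ.2)
  ext v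
  -- Applying `L` to the right leg, evaluating at `v` and multiplying shows that the corrections
  -- `L(D(Eₓ))` contribute zero in total.
  have hdefect := congrArg (LinearMap.mul' k P ∘ₗ
    (LinearMap.applyₗ v ∘ₗ L).lTensor P) hzero
  have hmul := congrArg (LinearMap.mul' k P) (hsum v)
  rw [mul'_splitting] at hmul
  simp only [map_sum, map_zero, LinearMap.comp_apply, LinearMap.lTensor_tmul,
    LinearMap.mul'_apply, LinearMap.applyₗ_apply_apply] at hdefect hmul
  rw [Submodule.coe_sum, LinearMap.sum_apply, hmul, ← sub_eq_zero, ← Finset.sum_sub_distrib]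
  rw [← neg_eq_zero, ← Finset.sum_neg_distrib, ← hdefect]
  refine Finset.sum_congr rfl fun x _ => ?_
  change -(contractRight (b.coord x.1) (splitting pr (φ.1 (e x.2))) *
    (E x v - L (colinearityDefect ρ δ (E x)) v) - _ * E x v) = _
  rw [mul_sub]
  abel

end DualBasis

end HopfGalois

theorem corollary2p6 {k H P V : Type*} [Field k] [Ring H] [HopfAlgebra k H]
    [Ring P] [Algebra k P] [AddCommGroup V] [Module k V] [FiniteDimensional k V]
    (hS : Function.Bijective (HopfAlgebra.antipode k : H →ₗ[k] H))
    (δ : P →ₐ[k] P ⊗[k] H) (hδ : HopfGalois.IsHopfGaloisExtension δ)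
    (hstrong : ∃ pr : HopfGalois.universalForms k P →ₗ[P] HopfGalois.universalForms k P,
      HopfGalois.IsStrongConnection δ pr)
    (ρ : V →ₗ[k] V ⊗[k] H) (hρ : HopfGalois.IsCorepresentation ρ) :
    Module.Finite (HopfGalois.coinvariants δ) (HopfGalois.colinearHom ρ δ) ∧
      Module.Projective (HopfGalois.coinvariants δ) (HopfGalois.colinearHom ρ δ) := by
  obtain ⟨pr, hpr⟩ := hstrong
  exact HopfGalois.finite_projective_colinearHom hδ hpr ρ
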